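/- There is a universal constant $C > 0$ with the following property. Let $W \ge 1$, $R$ and $K \le W$ be nonnegative integers such that $R$ divides $W$ and $$R \ge C\,[\,K \log W + \log^3 W\,].$$ Let $\Phi = HDF$ be an $R \times W$ random demodulator matrix, where - $F$ is the $W \times W$ (permuted) discrete Fourier matrix with entries $W^{-1/2} e^{-2\pi i n\omega/W}$, whose rows are indexed by $n = 0, 1, \dots, W-1$ and whose columns are indexed by the integers $\omega \in (-W/2, W/2]$; - $D = \operatorname{diag}(\varepsilon_0, \dots, \varepsilon_{W-1})$, where $\varepsilon_0, \dots, \varepsilon_{W-1}$ are independent random signs, equal to $\pm 1$ with probability $1/2$ each; - $H$ is the $R \times W$ matrix with entries in $\{0,1\}$ whose $r$th row, $r = 0, \dots, R-1$, has ones exactly in the columns $rW/R, \dots, (r+1)W/R - 1$ (columns numbered from $0$). Let $\Omega$ be a uniformly random set of $K$ column indices of $\Phi$, independent of $(\varepsilon_j)$. Write $\phi_\omega$ for the columns of $\Phi$, and let $$\mu_2(\Omega) = \max_{\alpha \notin \Omega} \Big[ \sum_{\omega \in \Omega} |\langle \phi_\alpha, \phi_\omega \rangle|^2 \Big]^{1/2}$$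 be the local 2-cumulative coherence of $\Omega$ with respect to $\Phi$. Then $$\mathbb{P}\Big\{ \mu_2(\Omega) \ge \frac{1}{\sqrt{16 \log W}} \Big\} \le 3 W^{-1}.$$ -/

import Mathlib

open MeasureTheory ProbabilityTheory
open scoped Matrix

noncomputable section

namespace RandomDemodulator

/-- The frequency attached to the column with (zero-based) index `k`. As `k` runs over
`0, …, W - 1`, it runs over the integers in `(-W/2, W/2]`; for even `W` these are
`0, ±1, …, ±(W/2 - 1), W/2`. The division is the floor division of natural numbers. -/
def frequency {W : ℕ} (k : Fin W) : ℤ := (k : ℤ) - (((W - 1) / 2 : ℕ) : ℤ)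

/-- The permuted `W × W` discrete Fourier matrix, with entries
`W^{-1/2} exp(-2πi n ω / W)`, where `n = 0, …, W - 1` and `ω` is the frequency of the column. -/
def fourierMatrix (W : ℕ) : Matrix (Fin W) (Fin W) ℂ :=
  Matrix.of fun n k =>
    (1 / (Real.sqrt W : ℂ)) *
      Complex.exp (-2 * Real.pi * Complex.I * (n : ℕ) * (frequency k : ℂ) / W)

/-- The diagonal matrix of a chipping sequence. -/
def chippingMatrix {W : ℕ} (ε : Fin W → ℝ) : Matrix (Fin W) (Fin W) ℂ :=
  Matrix.diagonal fun j => (ε j : ℂ)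

/-- The action of the accumulate-and-dump sampler when `R` divides `W`: row `r` consists of
`W / R` consecutive ones, starting at the (zero-based) position `r * (W / R)`. -/
def samplerMatrix (R W : ℕ) : Matrix (Fin R) (Fin W) ℂ :=
  Matrix.of fun r j =>
    if (r : ℕ) * (W / R) ≤ (j : ℕ) ∧ (j : ℕ) < ((r : ℕ) + 1) * (W / R) then 1 else 0

/-- The `R × W` demodulator matrix `Φ = H D F` built from the chipping sequence `ε`. -/
def demodulatorMatrix (R : ℕ) {W : ℕ} (ε : Fin W → ℝ) : Matrix (Fin R) (Fin W) ℂ :=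
  samplerMatrix R W * chippingMatrix ε * fourierMatrix W

/-- The local 2-cumulative coherence of a set `S` of column indices with respect to `Φ`: the
maximum over `α ∉ S` of the `ℓ₂` norm of the inner products `⟨φ_α, φ_ω⟩`, `ω ∈ S`.
(It is `0` if every column index belongs to `S`.) -/
def cumulativeCoherence {R W : ℕ} (Φ : Matrix (Fin R) (Fin W) ℂ) (S : Finset (Fin W)) : ℝ :=
  ⨆ α : {α : Fin W // α ∉ S},
    Real.sqrt (∑ ω ∈ S, ‖star (Φ.col (α : Fin W)) ⬝ᵥ Φ.col ω‖ ^ 2)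

/-- A Rademacher sequence: independent random variables, each equal to `1` or `-1` with
probability one half. -/
structure IsRademacherSequence {Ω : Type*} [MeasurableSpace Ω] (P : Measure Ω) {W : ℕ}
    (ε : Fin W → Ω → ℝ) : Prop where
  measurable : ∀ j, Measurable (ε j)
  indep : iIndepFun ε P
  prob_one : ∀ j, P {x | ε j x = 1} = 1 / 2
  prob_neg_one : ∀ j, P {x | ε j x = -1} = 1 / 2

/-- A uniformly random subset of size `K` of the `W` column indices: each of the `W.choose K`
subsets of size `K` has the same probability. -/
structure IsUniformSubset {Ω : Type*} [MeasurableSpace Ω] (P : Measure Ω) {W : ℕ} (K : ℕ)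
    (S : Ω → Finset (Fin W)) : Prop where
  measurable : Measurable S
  prob_eq : ∀ T : Finset (Fin W), T.card = K → P {x | S x = T} = ((W.choose K : ℕ) : ENNReal)⁻¹

end RandomDemodulator

end

/-!
# Local cumulative coherence of the random demodulator

The Gram matrix `G = Φᴴ Φ` is shown to be entrywise close to the identity with high probability
over the signs; for every such choice of signs, a random set of columns is then shown to have small
local cumulative coherence by a Chernoff bound over the random set alone.

*Signs.* Cut the index set into `R` blocks of length `W / R`. Row `r` of `Φ` only involves the signs
in block `r`, so `⟨φ_α, φ_ω⟩ = ∑_r u̅_r v_r` where `u_r`, `v_r` are Rademacher sums of variance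
`1 / R` over disjoint blocks, and the columns of `F` being orthonormal gives
`𝔼 ⟨φ_α, φ_ω⟩ = δ_{αω}`. A Rademacher sum has a bounded exponential square moment
(`expect_exp_sq_sum_sgn_le`, by linearizing the square with a Gaussian integral), hence each
`u̅_r v_r` is subexponential at scale `1 / R` (`expect_exp_chaos_le`). Bernstein's argument over the
independent blocks gives `|⟨φ_α, φ_ω⟩ - δ_{αω}|² < c log W / R` for all pairs, outside an event of
probability at most `W⁻¹` (`expect_gram_tail_le`, `expect_not_gram_close_le`).

*Subsets.* The rows of `Φ` are orthogonal with squared norm `W / R`, so row `α` of `G` has energy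
`(W / R) ‖φ_α‖² ≤ 2 W / R` (`sum_norm_inner_sq_eq`). Hence `∑_{ω ∈ Ω, ω ≠ α} |⟨φ_α, φ_ω⟩|²` has
mean at most `2 K / R`, which is small compared with `1 / (16 log W)`, and its terms are at most
`c log W / R`. A random `K`-subset contains a given set `T` with probability at most
`(K / W) ^ #T` (`card_filter_subset_le_pow`), so Chernoff's bound for Bernoulli sampling applies
(`card_filter_le_sum_le`). As `R / log² W` is a large multiple of `log W`, the failure probability
is at most `W⁻²` for each `α`, and at most `W⁻¹` after a union bound.

Both sources of randomness are finite, and the probabilities are computed as normalized counts over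
sign patterns and `K`-subsets (`measureReal_le_expect`).
-/

noncomputable section

namespace RandomDemodulator

open scoped BigOperators ComplexConjugate

/-! ### Averages over sign patterns -/

/-- The sign `±1` encoded by a bit. A pattern of signs indexed by `ι` is a function `ι → Bool`, and
the expectation over independent random signs is the uniform average `𝔼 e : ι → Bool, _`. -/
def sgn (b : Bool) : ℝ := if b then 1 else -1

lemma sgn_mul_self (b : Bool) : sgn b * sgn b = 1 := by cases b <;> simp [sgn]

lemma expect_bool (f : Bool → ℝ) : 𝔼 b, f b = (f true + f false) / 2 := by
  rw [Fintype.expect_eq_sum_div_card, Fintype.sum_bool]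
  simp

/-- Coordinates of a uniformly random function are independent: the average of a product of
functions of the single coordinates is the product of the averages. -/
lemma expect_prod_apply {ι κ : Type*} [Fintype ι] [DecidableEq ι] [Fintype κ] (f : ι → κ → ℝ) :
    𝔼 e : ι → κ, ∏ i, f i (e i) = ∏ i, 𝔼 k, f i k := by
  simp_rw [Fintype.expect_eq_sum_div_card, Finset.prod_div_distrib, Finset.prod_univ_sum,
    Fintype.piFinset_univ]
  simp

lemma expect_sgn_mul_sgn {ι : Type*} [Fintype ι] [DecidableEq ι] (i j : ι) :
    𝔼 e : ι → Bool, sgn (e i) * sgn (e j) = if i = j then 1 else 0 := by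
  split_ifs with h
  · subst h
    simp [sgn_mul_self]
  · have h1 (e : ι → Bool) : sgn (e i) * sgn (e j) =
        ∏ k, (if k = i then sgn (e k) else 1) * (if k = j then sgn (e k) else 1) := by
      rw [Finset.prod_mul_distrib]
      simp
    simp_rw [h1]
    rw [expect_prod_apply
      (fun k b => (if k = i then sgn b else 1) * (if k = j then sgn b else 1))]
    refine Finset.prod_eq_zero (Finset.mem_univ i) ?_
    rw [expect_bool]
    simp [h, sgn]

lemma expect_exp_sum_sgn_le {ι : Type*} [Fintype ι] [DecidableEq ι] (a : ι → ℝ) :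
    𝔼 e : ι → Bool, Real.exp (∑ i, a i * sgn (e i)) ≤ Real.exp ((∑ i, a i ^ 2) / 2) := by
  simp_rw [Real.exp_sum, Finset.sum_div]
  rw [expect_prod_apply (fun i b => Real.exp (a i * sgn b)), Real.exp_sum]
  refine Finset.prod_le_prod (fun i _ => Finset.expect_nonneg fun _ _ => (Real.exp_pos _).le)
    fun i _ => ?_
  rw [expect_bool]
  simpa [sgn, Real.cosh_eq] using Real.cosh_le_exp_half_sq (a i)

/-- Linearization of the exponential of a square by a Gaussian integral. -/
lemma integral_exp_neg_sq_add_mul (c : ℝ) :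
    Integrable (fun x : ℝ => Real.exp (-x ^ 2 + 2 * c * x)) ∧
      ∫ x : ℝ, Real.exp (-x ^ 2 + 2 * c * x) = √Real.pi * Real.exp (c ^ 2) := by
  have h (x : ℝ) : Real.exp (-x ^ 2 + 2 * c * x) =
      Real.exp (c ^ 2) * (fun y => Real.exp (-1 * y ^ 2)) (x - c) := by
    simp only [← Real.exp_add]
    ring_nf
  simp_rw [h]
  refine ⟨((integrable_exp_neg_mul_sq one_pos).comp_sub_right c).const_mul _, ?_⟩
  rw [integral_const_mul, integral_sub_right_eq_self (fun y => Real.exp (-1 * y ^ 2)) c,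
    integral_gaussian, div_one, mul_comm]

/-- Rademacher sums are subgaussian: the exponential square moment is bounded. -/
lemma expect_exp_sq_sum_sgn_le {ι : Type*} [Fintype ι] [DecidableEq ι] (a : ι → ℝ)
    (ha : ∑ i, a i ^ 2 ≤ 1) :
    𝔼 e : ι → Bool, Real.exp ((∑ i, a i * sgn (e i)) ^ 2 / 4) ≤ 2 := by
  set g : (ι → Bool) → ℝ := fun e => ∑ i, a i * sgn (e i) with hg
  have hpi : 0 < √Real.pi := Real.sqrt_pos.2 Real.pi_pos
  have h1 : √Real.pi * 𝔼 e, Real.exp (g e ^ 2 / 4) =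
      ∫ x : ℝ, 𝔼 e, Real.exp (-x ^ 2 + 2 * (g e / 2) * x) := by
    simp_rw [Fintype.expect_eq_sum_div_card]
    rw [integral_div, integral_finsetSum _ fun e _ => (integral_exp_neg_sq_add_mul _).1]
    simp_rw [(integral_exp_neg_sq_add_mul _).2, ← Finset.mul_sum, mul_div_assoc, div_pow]
    norm_num
  have h2 (x : ℝ) : 𝔼 e, Real.exp (-x ^ 2 + 2 * (g e / 2) * x) ≤
      Real.exp (-(1 / 2) * x ^ 2) := by
    have h3 (e : ι → Bool) : Real.exp (-x ^ 2 + 2 * (g e / 2) * x) =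
        Real.exp (-x ^ 2) * Real.exp (∑ i, (x * a i) * sgn (e i)) := by
      rw [← Real.exp_add]
      simp_rw [mul_assoc, ← Finset.mul_sum, hg]
      ring_nf
    simp_rw [h3, ← Finset.mul_expect]
    refine (mul_le_mul_of_nonneg_left (expect_exp_sum_sgn_le _) (Real.exp_pos _).le).trans ?_
    rw [← Real.exp_add, Real.exp_le_exp]
    simp_rw [mul_pow, ← Finset.mul_sum]
    nlinarith [mul_le_mul_of_nonneg_left ha (sq_nonneg x)]
  have h4 : √Real.pi * 𝔼 e, Real.exp (g e ^ 2 / 4) ≤ √Real.pi * √2 := by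
    rw [h1, ← Real.sqrt_mul Real.pi_pos.le]
    refine (integral_mono ?_ (integrable_exp_neg_mul_sq (by norm_num)) h2).trans_eq ?_
    · simp_rw [Fintype.expect_eq_sum_div_card]
      exact (integrable_finsetSum _ fun e _ => (integral_exp_neg_sq_add_mul _).1).div_const _
    · rw [integral_gaussian]
      norm_num
  refine (le_of_mul_le_mul_left h4 hpi).trans ?_
  rw [Real.sqrt_le_left (by norm_num)]
  norm_num

lemma exp_half_add_le (x y : ℝ) : Real.exp ((x + y) / 2) ≤ (Real.exp x + Real.exp y) / 2 := by
  have h := sq_nonneg (Real.exp (x / 2) - Real.exp (y / 2))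
  have hx : Real.exp x = Real.exp (x / 2) ^ 2 := by rw [← Real.exp_nat_mul]; ring_nf
  have hy : Real.exp y = Real.exp (y / 2) ^ 2 := by rw [← Real.exp_nat_mul]; ring_nf
  rw [hx, hy, add_div, Real.exp_add]
  nlinarith

lemma expect_exp_norm_sq_sum_sgn_le {ι : Type*} [Fintype ι] [DecidableEq ι] (a : ι → ℂ)
    (ha : ∑ i, ‖a i‖ ^ 2 ≤ 1) :
    𝔼 e : ι → Bool, Real.exp (‖∑ i, (sgn (e i) : ℂ) * a i‖ ^ 2 / 8) ≤ 2 := by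
  have hre : ∑ i, (a i).re ^ 2 ≤ 1 := (Finset.sum_le_sum fun i _ =>
    sq_le_sq' (neg_le_of_abs_le (Complex.abs_re_le_norm _)) (Complex.re_le_norm _)).trans ha
  have him : ∑ i, (a i).im ^ 2 ≤ 1 := (Finset.sum_le_sum fun i _ =>
    sq_le_sq' (neg_le_of_abs_le (Complex.abs_im_le_norm _)) (Complex.im_le_norm _)).trans ha
  have key (e : ι → Bool) : Real.exp (‖∑ i, (sgn (e i) : ℂ) * a i‖ ^ 2 / 8) ≤
      (Real.exp ((∑ i, (a i).re * sgn (e i)) ^ 2 / 4) +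
        Real.exp ((∑ i, (a i).im * sgn (e i)) ^ 2 / 4)) / 2 := by
    refine le_of_eq_of_le ?_ (exp_half_add_le _ _)
    rw [Complex.sq_norm, Complex.normSq_apply]
    simp only [Complex.re_sum, Complex.im_sum, Complex.re_ofReal_mul, Complex.im_ofReal_mul,
      mul_comm (sgn _)]
    ring_nf
  refine (Finset.expect_le_expect fun e _ => key e).trans ?_
  rw [← Finset.expect_div, Finset.expect_add_distrib]
  linarith [expect_exp_sq_sum_sgn_le _ hre, expect_exp_sq_sum_sgn_le _ him]

/-! ### Exponential moments of a Rademacher chaos of order two -/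

lemma exp_le_one_add_add_sq_mul_exp_abs (y : ℝ) :
    Real.exp y ≤ 1 + y + y ^ 2 * Real.exp |y| := by
  rcases le_total |y| 1 with h | h
  · have h1 := (abs_le.1 (Real.abs_exp_sub_one_sub_id_le h)).2
    have h2 : 1 ≤ Real.exp |y| := Real.one_le_exp (abs_nonneg y)
    nlinarith [sq_nonneg y]
  · rcases le_abs.1 h with h1 | h1
    · rw [abs_of_nonneg (by linarith)]
      nlinarith [mul_le_mul_of_nonneg_right (one_le_pow₀ (n := 2) h1) (Real.exp_pos y).le]
    · have h2 : Real.exp y ≤ 1 := Real.exp_le_one_iff.2 (by linarith)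
      have h3 : 1 ≤ Real.exp |y| := Real.one_le_exp (abs_nonneg y)
      nlinarith [sq_nonneg y]

/-- Second-order bound for the exponential, uniform for `l` in a neighbourhood of zero. -/
lemma exp_mul_le_of_abs_le {l : ℝ} (hl : |l| ≤ 1 / 16) (x : ℝ) :
    Real.exp (l * x) ≤ 1 + l * x + 512 * l ^ 2 * Real.exp (|x| / 8) := by
  have h1 := exp_le_one_add_add_sq_mul_exp_abs (l * x)
  have h2 : Real.exp |l * x| ≤ Real.exp (|x| / 16) := by
    rw [Real.exp_le_exp, abs_mul]
    nlinarith [abs_nonneg x]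
  have h3 : x ^ 2 ≤ 512 * Real.exp (|x| / 16) := by
    have := Real.quadratic_le_exp_of_nonneg (x := |x| / 16) (by positivity)
    have h4 := sq_abs x
    nlinarith [abs_nonneg x]
  have h5 : Real.exp (|x| / 8) = Real.exp (|x| / 16) * Real.exp (|x| / 16) := by
    rw [← Real.exp_add]; ring_nf
  have h6 : (l * x) ^ 2 * Real.exp |l * x| ≤
      l ^ 2 * (512 * Real.exp (|x| / 16)) * Real.exp (|x| / 16) := by
    rw [mul_pow]
    gcongr
  rw [h5]
  linarith

/-- The centered quadratic form `u̅ v - 𝔼 u̅ v` in random signs, where `u` and `v`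
are Rademacher sums of variance at most one, is subexponential: it has mean zero, and its modulus is
at most `1 + (|u|² + |v|²) / 2`, whose exponential moment is controlled by those of `|u|²`, `|v|²`. -/
lemma expect_exp_chaos_le {ι : Type*} [Fintype ι] [DecidableEq ι] (a b : ι → ℂ)
    (ha : ∑ i, ‖a i‖ ^ 2 ≤ 1) (hb : ∑ i, ‖b i‖ ^ 2 ≤ 1) (z : ℂ) (hz : ‖z‖ ≤ 1)
    {l : ℝ} (hl : |l| ≤ 1 / 16) :
    𝔼 e : ι → Bool, Real.exp (l * (z * (conj (∑ i, (sgn (e i) : ℂ) * a i) *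
      (∑ i, (sgn (e i) : ℂ) * b i) - ∑ i, conj (a i) * b i)).re) ≤ Real.exp (2048 * l ^ 2) := by
  set u : (ι → Bool) → ℂ := fun e => ∑ i, (sgn (e i) : ℂ) * a i with hu
  set v : (ι → Bool) → ℂ := fun e => ∑ i, (sgn (e i) : ℂ) * b i with hv
  set m : ℂ := ∑ i, conj (a i) * b i with hm
  set X : (ι → Bool) → ℝ := fun e => (z * (conj (u e) * v e - m)).re with hX
  have hm1 : ‖m‖ ≤ 1 := by
    calc ‖m‖ ≤ ∑ i, ‖conj (a i) * b i‖ := norm_sum_le _ _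
      _ ≤ ∑ i, (‖a i‖ ^ 2 + ‖b i‖ ^ 2) / 2 := Finset.sum_le_sum fun i _ => by
          rw [norm_mul, RCLike.norm_conj]
          nlinarith [sq_nonneg (‖a i‖ - ‖b i‖)]
      _ ≤ 1 := by
          rw [← Finset.sum_div, Finset.sum_add_distrib]
          linarith
  have hmean : 𝔼 e, X e = 0 := by
    have h1 (e : ι → Bool) : X e = ∑ i, ∑ j, (z * (conj (a i) * b j)).re *
        (sgn (e i) * sgn (e j) - if i = j then 1 else 0) := by
      simp only [mul_sub, Finset.sum_sub_distrib, mul_ite, mul_one, mul_zero,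
        Finset.sum_ite_eq, Finset.mem_univ, if_true]
      simp only [hX, hu, hv, hm, mul_sub, Complex.sub_re, map_sum, map_mul, Complex.conj_ofReal]
      rw [Finset.sum_mul_sum]
      simp only [Finset.mul_sum, Complex.re_sum]
      congr 1
      refine Finset.sum_congr rfl fun i _ => Finset.sum_congr rfl fun j _ => ?_
      rw [show z * (sgn (e i) * conj (a i) * (sgn (e j) * b j)) =
        ((sgn (e i) * sgn (e j) : ℝ) : ℂ) * (z * (conj (a i) * b j)) by push_cast; ring,
        Complex.re_ofReal_mul, mul_comm]
    simp_rw [h1]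
    rw [Finset.expect_sum_comm]
    refine Finset.sum_eq_zero fun i _ => ?_
    rw [Finset.expect_sum_comm]
    refine Finset.sum_eq_zero fun j _ => ?_
    rw [← Finset.mul_expect, Finset.expect_sub_distrib, expect_sgn_mul_sgn, Fintype.expect_const,
      sub_self, mul_zero]
  have habs (e : ι → Bool) : Real.exp (|X e| / 8) ≤
      Real.exp (1 / 8) * ((Real.exp (‖u e‖ ^ 2 / 8) + Real.exp (‖v e‖ ^ 2 / 8)) / 2) := by
    have h1 : |X e| ≤ 1 + (‖u e‖ ^ 2 + ‖v e‖ ^ 2) / 2 := by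
      calc |X e| ≤ ‖z * (conj (u e) * v e - m)‖ := Complex.abs_re_le_norm _
        _ ≤ 1 * ‖conj (u e) * v e - m‖ := by rw [norm_mul]; gcongr
        _ ≤ 1 * (‖conj (u e) * v e‖ + ‖m‖) := by gcongr; exact norm_sub_le _ _
        _ ≤ _ := by
          rw [norm_mul, RCLike.norm_conj]
          nlinarith [sq_nonneg (‖u e‖ - ‖v e‖)]
    calc Real.exp (|X e| / 8) ≤ Real.exp (1 / 8 + (‖u e‖ ^ 2 / 8 + ‖v e‖ ^ 2 / 8) / 2) := by
          rw [Real.exp_le_exp]; linarith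
      _ ≤ _ := by
          rw [Real.exp_add]
          gcongr
          exact exp_half_add_le _ _
  have hexp : 𝔼 e, Real.exp (|X e| / 8) ≤ 4 := by
    refine (Finset.expect_le_expect fun e _ => habs e).trans ?_
    rw [← Finset.mul_expect, ← Finset.expect_div, Finset.expect_add_distrib]
    have h1 := expect_exp_norm_sq_sum_sgn_le a ha
    have h2 := expect_exp_norm_sq_sum_sgn_le b hb
    have h3 : Real.exp (1 / 8) ≤ 2 := by
      have := Real.exp_bound_div_one_sub_of_interval (x := 1 / 8) (by norm_num) (by norm_num)
      norm_num at this ⊢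
      linarith
    calc _ ≤ Real.exp (1 / 8) * ((2 + 2) / 2) := by gcongr
      _ ≤ 4 := by linarith
  calc 𝔼 e, Real.exp (l * X e)
      ≤ 𝔼 e, (1 + l * X e + 512 * l ^ 2 * Real.exp (|X e| / 8)) :=
        Finset.expect_le_expect fun e _ => exp_mul_le_of_abs_le hl _
    _ = 1 + 512 * l ^ 2 * 𝔼 e, Real.exp (|X e| / 8) := by
        rw [Finset.expect_add_distrib, Finset.expect_add_distrib, ← Finset.mul_expect,
          ← Finset.mul_expect, hmean, Fintype.expect_const]
        ring
    _ ≤ 1 + 512 * l ^ 2 * 4 := by gcongr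
    _ ≤ Real.exp (2048 * l ^ 2) := by
        have := Real.add_one_le_exp (2048 * l ^ 2)
        linarith

/-! ### Tail bound for a block-diagonal chaos -/

/-- The blocks of the sign pattern are independent, so the exponential moments multiply. -/
lemma expect_exp_block_chaos_le {ρ κ : Type*} [Fintype ρ] [DecidableEq ρ] [Fintype κ]
    [DecidableEq κ] (a b : ρ → κ → ℂ) (ha : ∀ r, ∑ i, ‖a r i‖ ^ 2 ≤ 1)
    (hb : ∀ r, ∑ i, ‖b r i‖ ^ 2 ≤ 1) (z : ℂ) (hz : ‖z‖ ≤ 1) {l : ℝ} (hl : |l| ≤ 1 / 16) :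
    𝔼 e : ρ → κ → Bool, Real.exp (l * (z * ∑ r, (conj (∑ i, (sgn (e r i) : ℂ) * a r i) *
      (∑ i, (sgn (e r i) : ℂ) * b r i) - ∑ i, conj (a r i) * b r i)).re) ≤
      Real.exp (Fintype.card ρ * (2048 * l ^ 2)) := by
  have h (Z : ρ → ℂ) : Real.exp (l * (z * ∑ r, Z r).re) = ∏ r, Real.exp (l * (z * Z r).re) := by
    rw [Finset.mul_sum, Complex.re_sum, Finset.mul_sum, Real.exp_sum]
  simp_rw [h]
  rw [expect_prod_apply (fun r (e : κ → Bool) =>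
    Real.exp (l * (z * (conj (∑ i, (sgn (e i) : ℂ) * a r i) * (∑ i, (sgn (e i) : ℂ) * b r i) - ∑ i, conj (a r i) * b r i)).re)), Real.exp_nat_mul]
  refine (Finset.prod_le_prod (fun r _ => Finset.expect_nonneg fun _ _ => (Real.exp_pos _).le)
    fun r _ => expect_exp_chaos_le (a r) (b r) (ha r) (hb r) z hz hl).trans_eq ?_
  simp

open Classical in
/-- Bernstein-type tail bound. A complex number of modulus at least `√2 t` has real part at least
`t` after multiplication by one of the four fourth roots of unity. -/
lemma expect_block_chaos_tail_le {ρ κ : Type*} [Fintype ρ] [DecidableEq ρ] [Fintype κ]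
    [DecidableEq κ]
    (a b : ρ → κ → ℂ) (ha : ∀ r, ∑ i, ‖a r i‖ ^ 2 ≤ 1)
    (hb : ∀ r, ∑ i, ‖b r i‖ ^ 2 ≤ 1) {t : ℝ} (ht : 0 ≤ t) (ht' : t ≤ 256) :
    𝔼 e : ρ → κ → Bool, (if 2 * (Fintype.card ρ * t) ^ 2 ≤
      ‖∑ r, (conj (∑ i, (sgn (e r i) : ℂ) * a r i) *
        (∑ i, (sgn (e r i) : ℂ) * b r i) - ∑ i, conj (a r i) * b r i)‖ ^ 2 then (1 : ℝ) else 0) ≤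
      4 * Real.exp (-(Fintype.card ρ * t ^ 2 / 8192)) := by
  set Y : (ρ → κ → Bool) → ℂ := fun e => ∑ r, (conj (∑ i, (sgn (e r i) : ℂ) * a r i) *
        (∑ i, (sgn (e r i) : ℂ) * b r i) - ∑ i, conj (a r i) * b r i) with hY
  set N : ℝ := (Fintype.card ρ : ℝ) with hN
  have hN0 : 0 ≤ N := Nat.cast_nonneg _
  set l : ℝ := t / 4096 with hl
  have hl0 : 0 ≤ l := by positivity
  have hl1 : |l| ≤ 1 / 16 := by rw [abs_of_nonneg hl0, hl]; linarith
  have hone (z : ℂ) (hz : ‖z‖ ≤ 1) :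
      𝔼 e, Real.exp (l * (z * Y e).re - l * (N * t)) ≤ Real.exp (-(N * t ^ 2 / 8192)) := by
    simp_rw [sub_eq_add_neg, Real.exp_add]
    rw [← Finset.expect_mul]
    refine (mul_le_mul_of_nonneg_right (expect_exp_block_chaos_le a b ha hb z hz hl1)
      (Real.exp_pos _).le).trans_eq ?_
    rw [← Real.exp_add, ← hN, hl]
    ring_nf
  have hpt (e : ρ → κ → Bool) : (if 2 * (N * t) ^ 2 ≤ ‖Y e‖ ^ 2 then (1 : ℝ) else 0) ≤
      Real.exp (l * ((1 : ℂ) * Y e).re - l * (N * t)) +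
      Real.exp (l * ((-1 : ℂ) * Y e).re - l * (N * t)) +
      Real.exp (l * ((Complex.I : ℂ) * Y e).re - l * (N * t)) +
      Real.exp (l * ((-Complex.I : ℂ) * Y e).re - l * (N * t)) := by
    have p1 := Real.exp_pos (l * ((1 : ℂ) * Y e).re - l * (N * t))
    have p2 := Real.exp_pos (l * ((-1 : ℂ) * Y e).re - l * (N * t))
    have p3 := Real.exp_pos (l * ((Complex.I : ℂ) * Y e).re - l * (N * t))
    have p4 := Real.exp_pos (l * ((-Complex.I : ℂ) * Y e).re - l * (N * t))
    split_ifs with h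
    · have key (x : ℝ) (hx : N * t ≤ x) : 1 ≤ Real.exp (l * x - l * (N * t)) := by
        refine Real.one_le_exp ?_
        have := mul_le_mul_of_nonneg_left hx hl0
        linarith
      have hNt : 0 ≤ N * t := mul_nonneg hN0 ht
      rw [Complex.sq_norm, Complex.normSq_apply] at h
      have : N * t ≤ |(Y e).re| ∨ N * t ≤ |(Y e).im| := by
        by_contra! hc
        have h1 := mul_self_lt_mul_self (abs_nonneg _) hc.1
        have h2 := mul_self_lt_mul_self (abs_nonneg _) hc.2
        rw [abs_mul_abs_self] at h1 h2
        linarith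
      rcases this with h1 | h1 <;> rcases le_abs.1 h1 with h2 | h2
      · have := key ((1 : ℂ) * Y e).re (by simpa using h2)
        linarith
      · have := key ((-1 : ℂ) * Y e).re (by simpa using h2)
        linarith
      · have := key ((-Complex.I : ℂ) * Y e).re (by simpa using h2)
        linarith
      · have := key ((Complex.I : ℂ) * Y e).re (by simpa using h2)
        linarith
    · linarith
  refine (Finset.expect_le_expect fun e _ => hpt e).trans ?_
  rw [Finset.expect_add_distrib, Finset.expect_add_distrib, Finset.expect_add_distrib]
  linarith [hone 1 (by simp), hone (-1) (by simp), hone Complex.I (by simp),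
    hone (-Complex.I) (by simp)]

/-! ### The demodulator matrix -/

/-- Orthonormality of the columns of the discrete Fourier matrix. -/
lemma conjTranspose_fourierMatrix_mul_self {W : ℕ} (hW : 0 < W) :
    (fourierMatrix W)ᴴ * fourierMatrix W = 1 := by
  have hW0 : (W : ℂ) ≠ 0 := by exact_mod_cast hW.ne'
  have hW1 : (W : ℝ) ≠ 0 := by exact_mod_cast hW.ne'
  ext α ω
  set d : ℤ := frequency ω - frequency α with hd
  have hd' : d = (ω : ℤ) - (α : ℤ) := by simp [hd, frequency]
  set ζ : ℂ := Complex.exp (-2 * Real.pi * Complex.I * d / W) with hζ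
  have hsq : (1 / (Real.sqrt W : ℂ)) * (1 / (Real.sqrt W : ℂ)) = 1 / W := by
    rw [div_mul_div_comm, ← Complex.ofReal_mul, Real.mul_self_sqrt (Nat.cast_nonneg _)]
    simp
  have hterm (n : Fin W) : (fourierMatrix W)ᴴ α n * fourierMatrix W n ω =
      1 / W * ζ ^ (n : ℕ) := by
    rw [← hsq, hζ, ← Complex.exp_nat_mul]
    simp only [fourierMatrix, Matrix.conjTranspose_apply, Matrix.of_apply, star_mul',
      RCLike.star_def, ← Complex.exp_conj]
    rw [mul_mul_mul_comm, ← Complex.exp_add]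
    congr 2
    · simp
    · simp only [map_div₀, map_mul, map_neg, Complex.conj_ofReal, Complex.conj_I, map_natCast,
        map_intCast, map_ofNat, hd, Int.cast_sub]
      ring
  rw [Matrix.mul_apply, Finset.sum_congr rfl fun n _ => hterm n, ← Finset.mul_sum,
    Fin.sum_univ_eq_sum_range (fun n => ζ ^ n), Matrix.one_apply]
  split_ifs with h
  · have : ζ = 1 := by simp [hζ, hd', h]
    simp [this, hW0]
  · have hWζ : ζ ^ W = 1 := by
      rw [hζ, ← Complex.exp_nat_mul, Complex.exp_eq_one_iff]
      exact ⟨-d, by push_cast; field_simp⟩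
    have hζ1 : ζ ≠ 1 := by
      intro hc
      obtain ⟨k, hk⟩ := Complex.exp_eq_one_iff.1 hc
      have h2 : (-d : ℂ) = k * W := by
        have h3 : (2 * Real.pi * Complex.I : ℂ) ≠ 0 := Complex.two_pi_I_ne_zero
        field_simp at hk
        apply mul_left_cancel₀ h3
        linear_combination (2 * Real.pi * Complex.I) * hk
      have h3 : -d = k * W := by exact_mod_cast h2
      have hdvd : (W : ℤ) ∣ d := (dvd_neg).1 ⟨k, by rw [h3, mul_comm]⟩
      have hlt : |d| < W := by
        rw [abs_lt, hd']
        have := α.2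
        have := ω.2
        omega
      have := Int.eq_zero_of_abs_lt_dvd hdvd hlt
      apply h
      ext
      omega
    rw [geom_sum_eq hζ1, hWζ]
    simp

lemma norm_fourierMatrix_sq {W : ℕ} (n k : Fin W) : ‖fourierMatrix W n k‖ ^ 2 = 1 / W := by
  have h : (-2 * Real.pi * Complex.I * (n : ℕ) * (frequency k : ℂ) / W) =
      ((-2 * Real.pi * (n : ℕ) * (frequency k : ℝ) / W : ℝ) : ℂ) * Complex.I := by
    push_cast
    ring
  simp only [fourierMatrix, Matrix.of_apply]
  rw [h, norm_mul, Complex.norm_exp_ofReal_mul_I, mul_one, norm_div, norm_one, Complex.norm_real,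
    Real.norm_of_nonneg (Real.sqrt_nonneg _), div_pow, Real.sq_sqrt (Nat.cast_nonneg _), one_pow]

/-- In block coordinates `(r, i)`, row `r` of the sampler is the indicator of block `r`. -/
lemma samplerMatrix_apply_finProdFinEquiv {R L : ℕ} (r s : Fin R) (i : Fin L) :
    samplerMatrix R (R * L) r (finProdFinEquiv (s, i)) = if r = s then 1 else 0 := by
  have hR : 0 < R := r.pos
  simp only [samplerMatrix, Matrix.of_apply, finProdFinEquiv_apply_val, Nat.mul_div_cancel_left L hR]
  refine if_congr ?_ rfl rfl
  have hi := i.2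
  constructor
  · rintro ⟨h1, h2⟩
    ext
    refine le_antisymm ?_ ?_
    · by_contra! hc
      have := Nat.mul_le_mul_right L (Nat.succ_le_of_lt hc)
      have h3 : L * (s : ℕ) = s * L := mul_comm _ _
      rw [Nat.succ_mul] at this
      omega
    · by_contra! hc
      have := Nat.mul_le_mul_right L (Nat.succ_le_of_lt hc)
      have h3 : L * (s : ℕ) = s * L := mul_comm _ _
      rw [Nat.succ_eq_add_one] at this
      omega
  · rintro rfl
    constructor <;> nlinarith

lemma samplerMatrix_mul_conjTranspose (R L : ℕ) :
    samplerMatrix R (R * L) * (samplerMatrix R (R * L))ᴴ =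
      (L : ℂ) • (1 : Matrix (Fin R) (Fin R) ℂ) := by
  ext r s
  rw [Matrix.mul_apply, ← finProdFinEquiv.sum_comp, Fintype.sum_prod_type]
  simp only [Matrix.conjTranspose_apply, samplerMatrix_apply_finProdFinEquiv, Matrix.smul_apply,
    Matrix.one_apply]
  by_cases h : r = s <;> simp [h]

lemma demodulatorMatrix_apply {R L : ℕ} (ε : Fin (R * L) → ℝ) (r : Fin R) (ω : Fin (R * L)) :
    demodulatorMatrix R ε r ω = ∑ i : Fin L, (ε (finProdFinEquiv (r, i)) : ℂ) *
      fourierMatrix (R * L) (finProdFinEquiv (r, i)) ω := by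
  rw [demodulatorMatrix, Matrix.mul_assoc, Matrix.mul_apply, ← finProdFinEquiv.sum_comp,
    Fintype.sum_prod_type]
  simp [samplerMatrix_apply_finProdFinEquiv, chippingMatrix, Matrix.diagonal_mul]

/-- The rows of the demodulator matrix are orthogonal, with squared norm `W / R`. -/
lemma demodulatorMatrix_mul_conjTranspose {R L : ℕ} (hW : 0 < R * L) (ε : Fin (R * L) → ℝ)
    (hε : ∀ j, ε j * ε j = 1) :
    demodulatorMatrix R ε * (demodulatorMatrix R ε)ᴴ =
      (L : ℂ) • (1 : Matrix (Fin R) (Fin R) ℂ) := by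
  have hF : fourierMatrix (R * L) * (fourierMatrix (R * L))ᴴ = 1 :=
    mul_eq_one_comm.1 (conjTranspose_fourierMatrix_mul_self hW)
  have hD : chippingMatrix ε * (chippingMatrix ε)ᴴ = 1 := by
    rw [chippingMatrix, Matrix.diagonal_conjTranspose, Matrix.diagonal_mul_diagonal,
      ← Matrix.diagonal_one]
    congr 1
    ext j
    simp [← Complex.ofReal_mul, hε]
  rw [demodulatorMatrix, Matrix.conjTranspose_mul, Matrix.conjTranspose_mul,
    ← samplerMatrix_mul_conjTranspose]
  calc _ = samplerMatrix R (R * L) * (chippingMatrix ε *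
        (fourierMatrix (R * L) * (fourierMatrix (R * L))ᴴ) * (chippingMatrix ε)ᴴ) *
        (samplerMatrix R (R * L))ᴴ := by simp only [Matrix.mul_assoc]
    _ = _ := by rw [hF, Matrix.mul_one, hD, Matrix.mul_one]

/-- The energy of a row of the Gram matrix is `W / R` times its diagonal entry. -/
lemma sum_norm_inner_sq_eq {R L : ℕ} (hW : 0 < R * L) (ε : Fin (R * L) → ℝ)
    (hε : ∀ j, ε j * ε j = 1) (α : Fin (R * L)) :
    ∑ ω, ‖star ((demodulatorMatrix R ε).col α) ⬝ᵥ (demodulatorMatrix R ε).col ω‖ ^ 2 =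
      L * ‖star ((demodulatorMatrix R ε).col α) ⬝ᵥ (demodulatorMatrix R ε).col α‖ := by
  set Φ := demodulatorMatrix R ε with hΦ
  have hG (β γ : Fin (R * L)) : star (Φ.col β) ⬝ᵥ Φ.col γ = (Φᴴ * Φ) β γ := by
    simp [Matrix.mul_apply, dotProduct, Matrix.col]
  have h1 : (Φᴴ * Φ) * (Φᴴ * Φ)ᴴ = (L : ℂ) • (Φᴴ * Φ) := by
    rw [Matrix.conjTranspose_mul, Matrix.conjTranspose_conjTranspose]
    calc _ = Φᴴ * (Φ * Φᴴ) * Φ := by simp only [Matrix.mul_assoc]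
      _ = _ := by rw [demodulatorMatrix_mul_conjTranspose hW ε hε]; simp
  have h2 := congrFun (congrFun h1 α) α
  rw [Matrix.mul_apply, Matrix.smul_apply] at h2
  simp only [Matrix.conjTranspose_apply (Φᴴ * Φ), RCLike.star_def, Complex.mul_conj,
    Complex.normSq_eq_norm_sq] at h2
  simp_rw [hG]
  have h3 := congrArg norm h2
  rw [← Complex.ofReal_sum, Complex.norm_real,
    Real.norm_of_nonneg (Finset.sum_nonneg fun _ _ => sq_nonneg _), norm_smul] at h3
  simpa using h3

/-! ### Coherence -/

/-- The pattern of signs on the whole index set with given restrictions to the blocks. -/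
def chips {R L : ℕ} (e : Fin R → Fin L → Bool) (j : Fin (R * L)) : ℝ :=
  sgn (e (finProdFinEquiv.symm j).1 (finProdFinEquiv.symm j).2)

/-- The centered Gram entry, scaled by `R`, is a block chaos in which the rescaled entries `√R F` have
squared norm one in each block. -/
lemma mul_inner_sub_eq {R L : ℕ} (hW : 0 < R * L) (e : Fin R → Fin L → Bool)
    (α ω : Fin (R * L)) :
    (R : ℂ) * (star ((demodulatorMatrix R (chips e)).col α) ⬝ᵥ
        (demodulatorMatrix R (chips e)).col ω - if α = ω then 1 else 0) =
      ∑ r, (conj (∑ i, (sgn (e r i) : ℂ) *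
          (√R * fourierMatrix (R * L) (finProdFinEquiv (r, i)) α)) *
        (∑ i, (sgn (e r i) : ℂ) * (√R * fourierMatrix (R * L) (finProdFinEquiv (r, i)) ω)) -
        ∑ i, conj (√R * fourierMatrix (R * L) (finProdFinEquiv (r, i)) α) *
          (√R * fourierMatrix (R * L) (finProdFinEquiv (r, i)) ω)) := by
  have hR : (√R : ℂ) * √R = R := by
    rw [← Complex.ofReal_mul, Real.mul_self_sqrt (Nat.cast_nonneg _), Complex.ofReal_natCast]
  have h1 := congrFun (congrFun (conjTranspose_fourierMatrix_mul_self hW) α) ω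
  rw [Matrix.one_apply, Matrix.mul_apply, ← finProdFinEquiv.sum_comp, Fintype.sum_prod_type] at h1
  rw [Finset.sum_sub_distrib, mul_sub, ← h1]
  congr 1
  · simp only [dotProduct, Pi.star_apply, Matrix.col_apply, demodulatorMatrix_apply, chips,
      Equiv.symm_apply_apply, Finset.mul_sum Finset.univ _ (R : ℂ), RCLike.star_def]
    refine Finset.sum_congr rfl fun r _ => ?_
    simp_rw [mul_left_comm _ (√R : ℂ), ← Finset.mul_sum, map_mul, Complex.conj_ofReal, ← hR]
    ring
  · simp only [Finset.mul_sum, Matrix.conjTranspose_apply, RCLike.star_def, map_mul,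
      Complex.conj_ofReal, ← hR]
    refine Finset.sum_congr rfl fun r _ => Finset.sum_congr rfl fun i _ => ?_
    ring

open Classical in
/-- Every entry of the Gram matrix concentrates around the corresponding entry of the identity. -/
lemma expect_gram_tail_le {R L : ℕ} (hW : 0 < R * L) (α ω : Fin (R * L)) {t : ℝ} (ht : 0 ≤ t)
    (ht' : t ≤ 256) :
    𝔼 e : Fin R → Fin L → Bool, (if 2 * t ^ 2 ≤
      ‖star ((demodulatorMatrix R (chips e)).col α) ⬝ᵥ
        (demodulatorMatrix R (chips e)).col ω - if α = ω then 1 else 0‖ ^ 2 then (1 : ℝ) else 0) ≤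
      4 * Real.exp (-(R * t ^ 2 / 8192)) := by
  have hR0 : (0 : ℝ) < R := by exact_mod_cast Nat.pos_of_mul_pos_right hW
  have hL0 : (0 : ℝ) < L := by exact_mod_cast Nat.pos_of_mul_pos_left hW
  have hsum (β : Fin (R * L)) (r : Fin R) :
      ∑ i, ‖(√R : ℂ) * fourierMatrix (R * L) (finProdFinEquiv (r, i)) β‖ ^ 2 ≤ 1 := by
    simp_rw [norm_mul, mul_pow, norm_fourierMatrix_sq, Complex.norm_real,
      Real.norm_of_nonneg (Real.sqrt_nonneg _), Real.sq_sqrt hR0.le]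
    simp only [Finset.sum_const, Finset.card_univ, Fintype.card_fin, nsmul_eq_mul, Nat.cast_mul]
    apply le_of_eq
    field_simp
  have h := expect_block_chaos_tail_le
    (fun r i => (√R : ℂ) * fourierMatrix (R * L) (finProdFinEquiv (r, i)) α)
    (fun r i => (√R : ℂ) * fourierMatrix (R * L) (finProdFinEquiv (r, i)) ω)
    (hsum α) (hsum ω) ht ht'
  rw [Fintype.card_fin] at h
  refine le_of_eq_of_le (Finset.expect_congr rfl fun e _ => if_congr ?_ rfl rfl) h
  rw [← mul_inner_sub_eq hW, norm_mul, Complex.norm_natCast, mul_pow, mul_pow,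
    mul_left_comm (2 : ℝ), mul_le_mul_iff_right₀ (pow_pos hR0 2)]

/-! ### Sampling without replacement -/

lemma descFactorial_mul_pow_le {K W : ℕ} (h : K ≤ W) (t : ℕ) :
    K.descFactorial t * W ^ t ≤ W.descFactorial t * K ^ t := by
  induction t with
  | zero => simp
  | succ t ih =>
    rw [Nat.descFactorial_succ, Nat.descFactorial_succ, pow_succ, pow_succ]
    have h1 : (K - t) * W ≤ (W - t) * K := by
      rw [Nat.sub_mul, Nat.sub_mul, mul_comm K W]
      exact Nat.sub_le_sub_left (Nat.mul_le_mul_left t h) _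
    calc (K - t) * K.descFactorial t * (W ^ t * W)
        = ((K - t) * W) * (K.descFactorial t * W ^ t) := by ring
      _ ≤ ((W - t) * K) * (W.descFactorial t * K ^ t) := Nat.mul_le_mul h1 ih
      _ = _ := by ring

lemma card_filter_subset_le {α : Type*} [Fintype α] [DecidableEq α] (K : ℕ) (T : Finset α) :
    ((Finset.univ.powersetCard K).filter (T ⊆ ·)).card ≤
      (Fintype.card α - T.card).choose (K - T.card) := by
  rw [← Finset.card_compl, ← Finset.card_powersetCard]
  refine Finset.card_le_card_of_injOn (· \ T) (fun S hS => ?_) fun S hS S' hS' h => ?_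
  · simp only [Finset.coe_filter, Finset.mem_powersetCard, Set.mem_ofPred_eq, Finset.mem_coe]
      at hS ⊢
    refine ⟨fun x hx => by simp at hx ⊢; exact hx.2, ?_⟩
    rw [Finset.card_sdiff_of_subset hS.2, hS.1.2]
  · simp only [Finset.coe_filter, Set.mem_ofPred_eq] at hS hS'
    rw [← Finset.sdiff_union_of_subset hS.2, ← Finset.sdiff_union_of_subset hS'.2]
    exact congrArg (· ∪ T) h

/-- A uniformly random `K`-subset contains `T` with probability at most `(K / W) ^ #T`. -/
lemma card_filter_subset_le_pow {α : Type*} [Fintype α] [DecidableEq α] {K : ℕ}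
    (hK : K ≤ Fintype.card α) (T : Finset α) :
    (((Finset.univ.powersetCard K).filter (T ⊆ ·)).card : ℝ) ≤
      (Fintype.card α).choose K * ((K : ℝ) / Fintype.card α) ^ T.card := by
  set W := Fintype.card α with hW
  rcases le_or_gt T.card K with hT | hT
  · rcases Nat.eq_zero_or_pos W with h0 | h0
    · have hT0 : T.card = 0 := by omega
      have h1 := card_filter_subset_le K T
      rw [← hW, hT0, Nat.sub_zero, Nat.sub_zero] at h1
      rw [hT0, pow_zero, mul_one]
      exact_mod_cast h1
    have hTW : T.card ≤ W := hT.trans hK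
    have h1 := card_filter_subset_le K T
    have hd : (0 : ℝ) < W.choose T.card := by exact_mod_cast Nat.choose_pos hTW
    have h2 : ((W - T.card).choose (K - T.card) : ℝ) * W.choose T.card =
        W.choose K * K.choose T.card := by
      have := Nat.choose_mul (n := W) hT
      rw [mul_comm]
      exact_mod_cast this.symm
    have h3 : (K.choose T.card : ℝ) ≤ W.choose T.card * ((K : ℝ) / W) ^ T.card := by
      have h4 := descFactorial_mul_pow_le hK T.card
      rw [Nat.descFactorial_eq_factorial_mul_choose, Nat.descFactorial_eq_factorial_mul_choose,
        mul_assoc, mul_assoc] at h4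
      have h5 := Nat.le_of_mul_le_mul_left h4 (Nat.factorial_pos _)
      rw [div_pow, ← mul_div_assoc, le_div_iff₀ (by positivity)]
      exact_mod_cast h5
    refine (Nat.cast_le.2 h1).trans (le_of_mul_le_mul_right ?_ hd)
    rw [h2]
    calc (W.choose K : ℝ) * K.choose T.card
        ≤ W.choose K * (W.choose T.card * ((K : ℝ) / W) ^ T.card) := by gcongr
      _ = _ := by ring
  · have : (Finset.univ.powersetCard K).filter (T ⊆ ·) = ∅ := by
      refine Finset.filter_eq_empty_iff.2 fun S hS hTS => ?_
      have := Finset.card_le_card hTS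
      rw [(Finset.mem_powersetCard.1 hS).2] at this
      omega
    rw [this]
    simp only [Finset.card_empty, Nat.cast_zero]
    positivity

/-- The exponential moment of a sum over a random `K`-subset is at most that for Bernoulli sampling
at rate `K / W`. The product of the factors `exp (x ω) = 1 + (exp (x ω) - 1)` expands into
nonnegative terms indexed by subsets, to which the inclusion probabilities apply. -/
lemma sum_powersetCard_exp_le {α : Type*} [Fintype α] [DecidableEq α] {K : ℕ}
    (hK : K ≤ Fintype.card α) (x : α → ℝ) (hx : ∀ ω, 0 ≤ x ω) :
    ∑ S ∈ Finset.univ.powersetCard K, Real.exp (∑ ω ∈ S, x ω) ≤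
      (Fintype.card α).choose K *
        Real.exp ((K : ℝ) / Fintype.card α * ∑ ω, (Real.exp (x ω) - 1)) := by
  set p : ℝ := (K : ℝ) / Fintype.card α with hp
  have hp0 : 0 ≤ p := by positivity
  have hy (ω : α) : 0 ≤ Real.exp (x ω) - 1 := sub_nonneg.2 (Real.one_le_exp (hx ω))
  have h1 (S : Finset α) : Real.exp (∑ ω ∈ S, x ω) =
      ∑ T : Finset α, if T ⊆ S then ∏ ω ∈ T, (Real.exp (x ω) - 1) else 0 := by
    rw [← Finset.sum_filter, Real.exp_sum]
    have : Finset.univ.filter (· ⊆ S) = S.powerset := by ext; simp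
    rw [this, ← Finset.prod_one_add]
    simp
  simp_rw [h1]
  rw [Finset.sum_comm]
  calc ∑ T : Finset α, ∑ S ∈ Finset.univ.powersetCard K,
        (if T ⊆ S then ∏ ω ∈ T, (Real.exp (x ω) - 1) else 0)
      ≤ ∑ T : Finset α, (Fintype.card α).choose K * ∏ ω ∈ T, (p * (Real.exp (x ω) - 1)) := by
        refine Finset.sum_le_sum fun T _ => ?_
        rw [← Finset.sum_filter, Finset.sum_const, nsmul_eq_mul, Finset.prod_mul_distrib,
          Finset.prod_const, ← mul_assoc]
        exact mul_le_mul_of_nonneg_right (card_filter_subset_le_pow hK T)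
          (Finset.prod_nonneg fun ω _ => hy ω)
    _ = (Fintype.card α).choose K * ∏ ω, (1 + p * (Real.exp (x ω) - 1)) := by
        rw [← Finset.mul_sum, Finset.prod_one_add, Finset.powerset_univ]
    _ ≤ _ := by
        rw [Finset.mul_sum, Real.exp_sum]
        gcongr with ω
        · intro ω _
          have := mul_nonneg hp0 (hy ω)
          positivity
        · rw [add_comm]
          exact Real.add_one_le_exp _

lemma exp_sub_one_le_two_mul {y : ℝ} (h0 : 0 ≤ y) (h1 : y ≤ 1) : Real.exp y - 1 ≤ 2 * y := by
  have h := (abs_le.1 (Real.abs_exp_sub_one_sub_id_le (abs_le.2 ⟨by linarith, h1⟩))).2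
  nlinarith

/-- Chernoff's bound for the sum of nonnegative weights, each at most `B`, over a uniformly random
`K`-subset. -/
lemma card_filter_le_sum_le {α : Type*} [Fintype α] [DecidableEq α] {K : ℕ}
    (hK : K ≤ Fintype.card α) (x : α → ℝ) (hx : ∀ ω, 0 ≤ x ω) {B : ℝ} (hB : 0 < B)
    (hxB : ∀ ω, x ω ≤ B) (s : ℝ) :
    (((Finset.univ.powersetCard K).filter fun S => s ≤ ∑ ω ∈ S, x ω).card : ℝ) ≤
      (Fintype.card α).choose K *
        Real.exp ((2 * ((K : ℝ) / Fintype.card α) * ∑ ω, x ω - s) / B) := by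
  have h1 := sum_powersetCard_exp_le hK (fun ω => x ω / B) fun ω => div_nonneg (hx ω) hB.le
  have h2 : (((Finset.univ.powersetCard K).filter fun S => s ≤ ∑ ω ∈ S, x ω).card : ℝ) ≤
      ∑ S ∈ Finset.univ.powersetCard K, Real.exp (∑ ω ∈ S, x ω / B - s / B) := by
    rw [Finset.cast_card, Finset.sum_filter]
    refine Finset.sum_le_sum fun S _ => ?_
    split_ifs with h
    · refine Real.one_le_exp ?_
      rw [← Finset.sum_div, ← sub_div]
      exact div_nonneg (sub_nonneg.2 h) hB.le
    · positivity
  refine h2.trans ?_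
  simp_rw [sub_eq_add_neg, Real.exp_add]
  rw [← Finset.sum_mul]
  refine (mul_le_mul_of_nonneg_right h1 (Real.exp_pos _).le).trans ?_
  rw [mul_assoc, ← Real.exp_add]
  gcongr
  have h3 : ∑ ω, (Real.exp (x ω / B) - 1) ≤ ∑ ω, 2 * (x ω / B) := Finset.sum_le_sum fun ω _ =>
    exp_sub_one_le_two_mul (div_nonneg (hx ω) hB.le) ((div_le_one hB).2 (hxB ω))
  calc (K : ℝ) / Fintype.card α * ∑ ω, (Real.exp (x ω / B) - 1) + -(s / B)
      ≤ (K : ℝ) / Fintype.card α * ∑ ω, 2 * (x ω / B) + -(s / B) := by gcongr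
    _ = _ := by
      rw [← Finset.mul_sum, ← Finset.sum_div]
      ring

/-! ### From the probability space to finite averages -/

lemma IsRademacherSequence.ae_eq {Ω : Type*} [MeasurableSpace Ω] {P : Measure Ω}
    [IsProbabilityMeasure P] {W : ℕ} {ε : Fin W → Ω → ℝ} (hε : IsRademacherSequence P ε) :
    ∀ᵐ x ∂P, ∃ b : Fin W → Bool, (fun j => ε j x) = fun j => sgn (b j) := by
  have h (j : Fin W) : ∀ᵐ x ∂P, ε j x = 1 ∨ ε j x = -1 := by
    have m1 : MeasurableSet {x | ε j x = 1} := hε.measurable j (measurableSet_singleton 1)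
    have m2 : MeasurableSet {x | ε j x = -1} := hε.measurable j (measurableSet_singleton (-1))
    have hd : Disjoint {x | ε j x = 1} {x | ε j x = -1} := by
      rw [Set.disjoint_left]
      intro x h1 h2
      have h1' : ε j x = 1 := h1
      have h2' : ε j x = -1 := h2
      linarith
    have hu : P ({x | ε j x = 1} ∪ {x | ε j x = -1}) = 1 := by
      rw [measure_union hd m2, hε.prob_one, hε.prob_neg_one, ENNReal.add_halves]
    exact (mem_ae_iff_prob_eq_one (m1.union m2)).2 hu
  filter_upwards [ae_all_iff.2 h] with x hx
  refine ⟨fun j => decide (ε j x = 1), funext fun j => ?_⟩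
  rcases hx j with h1 | h1
  · simp [sgn, h1]
  · have : (-1 : ℝ) ≠ 1 := by norm_num
    simp [sgn, h1, this]

lemma IsRademacherSequence.measure_eq {Ω : Type*} [MeasurableSpace Ω] {P : Measure Ω}
    {W : ℕ} {ε : Fin W → Ω → ℝ} (hε : IsRademacherSequence P ε) (b : Fin W → Bool) :
    P ((fun x j => ε j x) ⁻¹' {fun j => sgn (b j)}) = (1 / 2) ^ W := by
  have h := hε.indep.measure_inter_preimage_eq_mul Finset.univ
    (sets := fun j => {sgn (b j)}) fun j _ => measurableSet_singleton _
  have h1 (j : Fin W) : P (ε j ⁻¹' {sgn (b j)}) = 1 / 2 := by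
    cases hb : b j
    · exact hε.prob_neg_one j
    · exact hε.prob_one j
  simp_rw [h1] at h
  rw [Finset.prod_const, Finset.card_univ, Fintype.card_fin] at h
  rw [← h]
  congr 1
  ext x
  simp [funext_iff]

lemma IsUniformSubset.ae_card_eq {Ω : Type*} [MeasurableSpace Ω] {P : Measure Ω}
    [IsProbabilityMeasure P] {W K : ℕ} (hK : K ≤ W) {S : Ω → Finset (Fin W)}
    (hS : IsUniformSubset P K S) : ∀ᵐ x ∂P, (S x).card = K := by
  have hm (T : Finset (Fin W)) : MeasurableSet {x | S x = T} :=
    hS.measurable (measurableSet_singleton T)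
  have hset : {x | (S x).card = K} =
      ⋃ T ∈ (Finset.univ : Finset (Fin W)).powersetCard K, {x | S x = T} := by
    ext x
    simp
  have hu : P {x | (S x).card = K} = 1 := by
    rw [hset, measure_biUnion_finset _ fun T _ => hm T]
    · rw [Finset.sum_congr rfl fun T hT => hS.prob_eq T (Finset.mem_powersetCard.1 hT).2,
        Finset.sum_const, Finset.card_powersetCard, Finset.card_univ, Fintype.card_fin,
        nsmul_eq_mul]
      exact ENNReal.mul_inv_cancel (by exact_mod_cast (Nat.choose_pos hK).ne')
        (ENNReal.natCast_ne_top _)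
    · intro T _ T' _ hTT'
      rw [Function.onFun, Set.disjoint_left]
      intro x h1 h2
      exact hTT' ((show S x = T from h1).symm.trans h2)
  refine (mem_ae_iff_prob_eq_one ?_).2 hu
  rw [hset]
  exact Finset.measurableSet_biUnion _ fun T _ => hm T

open Classical in
/-- The joint law of the signs and the subset is uniform on the product of the sign patterns and
the `K`-subsets, so that probabilities are normalized counts. -/
lemma measureReal_le_expect {Ω : Type*} [MeasurableSpace Ω] {P : Measure Ω}
    [IsProbabilityMeasure P] {W K : ℕ} (hK : K ≤ W) {ε : Fin W → Ω → ℝ}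
    {S : Ω → Finset (Fin W)} (hε : IsRademacherSequence P ε) (hS : IsUniformSubset P K S)
    (hind : IndepFun (fun x j => ε j x) S P) (Q : (Fin W → ℝ) → Finset (Fin W) → Prop) :
    P.real {x | Q (fun j => ε j x) (S x)} ≤ 𝔼 b : Fin W → Bool,
      (((Finset.univ.powersetCard K).filter (Q fun j => sgn (b j))).card : ℝ) / W.choose K := by
  set F : (Fin W → Bool) → Finset (Finset (Fin W)) := fun b =>
    (Finset.univ.powersetCard K).filter (Q fun j => sgn (b j)) with hF
  have h1 : P {x | Q (fun j => ε j x) (S x)} ≤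
      P (⋃ b ∈ (Finset.univ : Finset (Fin W → Bool)), ⋃ T ∈ F b,
        ((fun x j => ε j x) ⁻¹' {fun j => sgn (b j)} ∩ S ⁻¹' {T})) := by
    refine measure_mono_ae ?_
    filter_upwards [hε.ae_eq, hS.ae_card_eq hK] with x hx hcard hQ
    obtain ⟨b, hb⟩ := hx
    have hQ' : Q (fun j => sgn (b j)) (S x) := hb ▸ hQ
    refine Set.mem_biUnion (x := b) (Finset.mem_coe.2 (Finset.mem_univ b)) ?_
    refine Set.mem_biUnion (x := S x) (Finset.mem_coe.2 ?_) ⟨hb, rfl⟩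
    exact Finset.mem_filter.2 ⟨Finset.mem_powersetCard.2 ⟨Finset.subset_univ _, hcard⟩, hQ'⟩
  have h2 : P {x | Q (fun j => ε j x) (S x)} ≤
      ∑ b : Fin W → Bool, ∑ _T ∈ F b, (1 / 2 : ENNReal) ^ W * ((W.choose K : ℕ) : ENNReal)⁻¹ := by
    refine h1.trans ((measure_biUnion_finset_le _ _).trans (Finset.sum_le_sum fun b _ =>
      (measure_biUnion_finset_le _ _).trans (Finset.sum_le_sum fun T hT => ?_)))
    rw [hind.measure_inter_preimage_eq_mul _ _ (measurableSet_singleton _)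
      (measurableSet_singleton _), hε.measure_eq]
    refine le_of_eq (congrArg _ ?_)
    exact hS.prob_eq T (Finset.mem_powersetCard.1 (Finset.mem_filter.1 hT).1).2
  have hfin : ∑ b : Fin W → Bool, ∑ _T ∈ F b,
      (1 / 2 : ENNReal) ^ W * ((W.choose K : ℕ) : ENNReal)⁻¹ ≠ ⊤ := by
    refine ENNReal.sum_ne_top.2 fun b _ => ENNReal.sum_ne_top.2 fun T _ => ?_
    refine ENNReal.mul_ne_top (ENNReal.pow_ne_top (by simp)) ?_
    exact ENNReal.inv_ne_top.2 (by exact_mod_cast (Nat.choose_pos hK).ne')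
  refine (ENNReal.toReal_mono hfin h2).trans_eq ?_
  simp only [Finset.sum_const, nsmul_eq_mul]
  rw [ENNReal.toReal_sum fun b _ => ?_, Fintype.expect_eq_sum_div_card, Finset.sum_div]
  · refine Finset.sum_congr rfl fun b _ => ?_
    simp [ENNReal.toReal_mul]
    ring
  · refine ENNReal.mul_ne_top (ENNReal.natCast_ne_top _) ?_
    refine ENNReal.mul_ne_top (ENNReal.pow_ne_top (by simp)) ?_
    exact ENNReal.inv_ne_top.2 (by exact_mod_cast (Nat.choose_pos hK).ne')

lemma expect_eq_expect_chips {R L : ℕ} (f : (Fin (R * L) → ℝ) → ℝ) :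
    𝔼 b : Fin (R * L) → Bool, f (fun j => sgn (b j)) = 𝔼 e : Fin R → Fin L → Bool, f (chips e) := by
  refine Fintype.expect_equiv
    ((Equiv.arrowCongr finProdFinEquiv.symm (Equiv.refl Bool)).trans (Equiv.curry _ _ _)) _ _ ?_
  intro b
  congr 1
  ext j
  change sgn (b j) = sgn (b (finProdFinEquiv (finProdFinEquiv.symm j)))
  rw [Equiv.apply_symm_apply]

/-! ### The local cumulative coherence -/

lemma exists_of_le_cumulativeCoherence {R W : ℕ} (Φ : Matrix (Fin R) (Fin W) ℂ)
    (S : Finset (Fin W)) {c : ℝ} (hc : 0 < c) (h : c ≤ cumulativeCoherence Φ S) :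
    ∃ α ∉ S, c ^ 2 ≤ ∑ ω ∈ S, ‖star (Φ.col α) ⬝ᵥ Φ.col ω‖ ^ 2 := by
  rcases isEmpty_or_nonempty {α : Fin W // α ∉ S} with hem | hne
  · rw [cumulativeCoherence, Real.iSup_of_isEmpty] at h
    linarith
  · obtain ⟨α, hα⟩ := exists_eq_ciSup_of_finite (f := fun α : {α : Fin W // α ∉ S} =>
      Real.sqrt (∑ ω ∈ S, ‖star (Φ.col (α : Fin W)) ⬝ᵥ Φ.col ω‖ ^ 2))
    rw [cumulativeCoherence, ← hα] at h
    exact ⟨α, α.2, (Real.le_sqrt' hc).1 h⟩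

open Classical in
/-- For a fixed matrix `Φ` with small coherence whose Gram matrix has rows of energy at most `E`,
most subsets have small local cumulative coherence. -/
lemma card_filter_le_cumulativeCoherence_le {R W K : ℕ} (hK : K ≤ W)
    (Φ : Matrix (Fin R) (Fin W) ℂ) {B E c : ℝ} (hB : 0 < B) (hc : 0 < c)
    (hcoh : ∀ α ω, α ≠ ω → ‖star (Φ.col α) ⬝ᵥ Φ.col ω‖ ^ 2 ≤ B)
    (hE : ∀ α, ∑ ω, ‖star (Φ.col α) ⬝ᵥ Φ.col ω‖ ^ 2 ≤ E) :
    (((Finset.univ.powersetCard K).filter fun S => c ≤ cumulativeCoherence Φ S).card : ℝ) ≤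
      W * (W.choose K * Real.exp ((2 * ((K : ℝ) / W) * E - c ^ 2) / B)) := by
  -- The diagonal term is discarded, which is harmless since `α ∉ S`.
  set x : Fin W → Fin W → ℝ := fun α ω =>
    if ω = α then 0 else ‖star (Φ.col α) ⬝ᵥ Φ.col ω‖ ^ 2 with hx
  have hsub : ((Finset.univ.powersetCard K).filter fun S => c ≤ cumulativeCoherence Φ S) ⊆
      Finset.univ.biUnion fun α =>
        (Finset.univ.powersetCard K).filter fun S => c ^ 2 ≤ ∑ ω ∈ S, x α ω := by
    intro S hS
    obtain ⟨hS1, hS2⟩ := Finset.mem_filter.1 hS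
    obtain ⟨α, hα, hle⟩ := exists_of_le_cumulativeCoherence Φ S hc hS2
    refine Finset.mem_biUnion.2 ⟨α, Finset.mem_univ α, Finset.mem_filter.2 ⟨hS1, ?_⟩⟩
    refine hle.trans_eq (Finset.sum_congr rfl fun ω hω => ?_)
    simp only [hx]
    rw [if_neg (ne_of_mem_of_not_mem hω hα)]
  refine (Nat.cast_le.2 ((Finset.card_le_card hsub).trans Finset.card_biUnion_le)).trans ?_
  rw [Nat.cast_sum]
  refine (Finset.sum_le_card_nsmul Finset.univ _
    (W.choose K * Real.exp ((2 * ((K : ℝ) / W) * E - c ^ 2) / B)) fun α _ => ?_).trans_eq (by simp)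
  have h := card_filter_le_sum_le (K := K) (by simpa using hK) (x α)
    (fun ω => by simp only [hx]; split_ifs <;> positivity) hB
    (fun ω => by
      simp only [hx]
      split_ifs with h
      · exact hB.le
      · exact hcoh α ω (Ne.symm h)) (c ^ 2)
  rw [Fintype.card_fin] at h
  have hxE : ∑ ω, x α ω ≤ E := by
    refine (Finset.sum_le_sum fun ω _ => ?_).trans (hE α)
    simp only [hx]
    split_ifs
    · positivity
    · exact le_rfl
  refine le_trans (le_of_eq ?_) (h.trans ?_)
  · congr!
  · gcongr

open Classical in
/-- The Gram matrix is entrywise close to the identity for most sign patterns. -/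
lemma expect_not_gram_close_le {R L : ℕ} (hW : 0 < R * L) {t : ℝ} (ht : 0 ≤ t) (ht' : t ≤ 256) :
    𝔼 e : Fin R → Fin L → Bool, (if ∀ α ω : Fin (R * L),
      ‖star ((demodulatorMatrix R (chips e)).col α) ⬝ᵥ (demodulatorMatrix R (chips e)).col ω -
        if α = ω then 1 else 0‖ ^ 2 ≤ 2 * t ^ 2 then (0 : ℝ) else 1) ≤
      ((R * L : ℕ) : ℝ) ^ 2 * (4 * Real.exp (-(R * t ^ 2 / 8192))) := by
  set d : (Fin R → Fin L → Bool) → Fin (R * L) → Fin (R * L) → ℝ := fun e α ω =>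
    ‖star ((demodulatorMatrix R (chips e)).col α) ⬝ᵥ (demodulatorMatrix R (chips e)).col ω -
        if α = ω then 1 else 0‖ ^ 2 with hd
  have hpt (e : Fin R → Fin L → Bool) : (if ∀ α ω, d e α ω ≤ 2 * t ^ 2 then (0 : ℝ) else 1) ≤
      ∑ α, ∑ ω, if 2 * t ^ 2 ≤ d e α ω then (1 : ℝ) else 0 := by
    have h0 (α ω) : (0 : ℝ) ≤ if 2 * t ^ 2 ≤ d e α ω then (1 : ℝ) else 0 := by
      split_ifs <;> norm_num
    split_ifs with h
    · exact Finset.sum_nonneg fun α _ => Finset.sum_nonneg fun ω _ => h0 α ω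
    · push Not at h
      obtain ⟨α, ω, hαω⟩ := h
      calc (1 : ℝ) = if 2 * t ^ 2 ≤ d e α ω then (1 : ℝ) else 0 := (if_pos hαω.le).symm
        _ ≤ ∑ ω, if 2 * t ^ 2 ≤ d e α ω then (1 : ℝ) else 0 :=
          Finset.single_le_sum (fun ω _ => h0 α ω) (Finset.mem_univ ω)
        _ ≤ _ := Finset.single_le_sum
          (f := fun α => ∑ ω, if 2 * t ^ 2 ≤ d e α ω then (1 : ℝ) else 0)
          (fun α _ => Finset.sum_nonneg fun ω _ => h0 α ω) (Finset.mem_univ α)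
  refine (Finset.expect_le_expect fun e _ => hpt e).trans ?_
  rw [Finset.expect_sum_comm]
  simp_rw [Finset.expect_sum_comm]
  refine (Finset.sum_le_sum fun α _ => Finset.sum_le_sum fun ω _ =>
    expect_gram_tail_le hW α ω ht ht').trans_eq ?_
  rw [Finset.sum_const, Finset.sum_const, Finset.card_univ, Fintype.card_fin, nsmul_eq_mul,
    nsmul_eq_mul, ← mul_assoc, ← sq]

open Classical in
lemma expect_card_filter_le {R L K : ℕ} (hW : 4 ≤ R * L) (hK : K ≤ R * L)
    (hC : 5242880 * (K * Real.log (R * L : ℕ) + Real.log (R * L : ℕ) ^ 3) ≤ R) :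
    𝔼 e : Fin R → Fin L → Bool, (((Finset.univ.powersetCard K).filter fun S =>
        1 / Real.sqrt (16 * Real.log (R * L : ℕ)) ≤
          cumulativeCoherence (demodulatorMatrix R (chips e)) S).card : ℝ) /
        (R * L).choose K ≤ 3 * ((R * L : ℕ) : ℝ)⁻¹ := by
  have hWpos : 0 < R * L := by omega
  set W : ℝ := ((R * L : ℕ) : ℝ) with hWdef
  set l : ℝ := Real.log W with hl
  have hW4 : (4 : ℝ) ≤ W := by rw [hWdef]; exact_mod_cast hW
  have hW0 : 0 < W := by linarith
  have hR0 : (0 : ℝ) < R := by exact_mod_cast Nat.pos_of_mul_pos_right hWpos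
  have hL0 : (0 : ℝ) < L := by exact_mod_cast Nat.pos_of_mul_pos_left hWpos
  have hl1 : 1 ≤ l := by
    rw [hl, Real.le_log_iff_exp_le hW0]
    linarith [Real.exp_one_lt_d9]
  have hl0 : 0 < l := by linarith
  have hexp (n : ℕ) : Real.exp (-(n * l)) = (W ^ n)⁻¹ := by
    rw [Real.exp_neg, Real.exp_nat_mul, hl, Real.exp_log hW0]
  have hKl : 0 ≤ (K : ℝ) * l := by positivity
  have hl3 : l ≤ l ^ 3 := le_self_pow₀ hl1 (by norm_num)
  have hR1 : 5242880 * l ≤ R := by nlinarith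
  -- The deviation `t` makes each entry of the Gram matrix fail with probability at most `4 W⁻⁵`.
  set t : ℝ := Real.sqrt (40960 * l / R) with ht
  have ht2 : t ^ 2 = 40960 * l / R := Real.sq_sqrt (by positivity)
  have htsmall : 2 * t ^ 2 ≤ 1 := by
    rw [ht2, ← mul_div_assoc, div_le_one hR0]
    linarith
  have ht256 : t ≤ 256 := by nlinarith [Real.sqrt_nonneg (40960 * l / R)]
  have hc : 0 < 1 / Real.sqrt (16 * l) := by positivity
  have hc2 : (1 / Real.sqrt (16 * l)) ^ 2 = 1 / (16 * l) := by
    rw [div_pow, one_pow, Real.sq_sqrt (by positivity)]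
  have hchoose : (0 : ℝ) < (R * L).choose K := by exact_mod_cast Nat.choose_pos hK
  have hexponent : (2 * ((K : ℝ) / W) * (L * 2) - (1 / Real.sqrt (16 * l)) ^ 2) / (2 * t ^ 2) ≤
      -((2 : ℕ) * l) := by
    have hKR : (K : ℝ) / W * L = K / R := by
      rw [hWdef, Nat.cast_mul]
      field_simp
    have h1 : (K : ℝ) / R ≤ 1 / (128 * l) := by
      rw [div_le_div_iff₀ hR0 (by positivity)]
      nlinarith [pow_pos hl0 3]
    have h2 : 2 * ((K : ℝ) / W) * (L * 2) - (1 / Real.sqrt (16 * l)) ^ 2 ≤ -(1 / (32 * l)) := by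
      rw [hc2]
      have h3 : (1 : ℝ) / (128 * l) = 1 / l / 128 := by field_simp
      have h4 : (1 : ℝ) / (16 * l) = 1 / l / 16 := by field_simp
      have h5 : (1 : ℝ) / (32 * l) = 1 / l / 32 := by field_simp
      rw [h4, h5]
      rw [h3] at h1
      linarith
    have htpos : 0 < 2 * t ^ 2 := by rw [ht2]; positivity
    rw [div_le_iff₀ htpos]
    refine h2.trans ?_
    rw [ht2, neg_mul, neg_le_neg_iff, ← mul_div_assoc, ← mul_div_assoc,
      div_le_div_iff₀ hR0 (by positivity)]
    push_cast
    nlinarith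
  -- If the Gram matrix is not close to the identity, all subsets are counted as bad.
  have hpt (e : Fin R → Fin L → Bool) :
      (((Finset.univ.powersetCard K).filter fun S => 1 / Real.sqrt (16 * l) ≤
          cumulativeCoherence (demodulatorMatrix R (chips e)) S).card : ℝ) /
        (R * L).choose K ≤ (if ∀ α ω : Fin (R * L),
      ‖star ((demodulatorMatrix R (chips e)).col α) ⬝ᵥ (demodulatorMatrix R (chips e)).col ω -
        if α = ω then 1 else 0‖ ^ 2 ≤ 2 * t ^ 2 then (0 : ℝ) else 1) + W⁻¹ := by
    rw [div_le_iff₀ hchoose]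
    split_ifs with h
    · have hdiag (α : Fin (R * L)) : ‖star ((demodulatorMatrix R (chips e)).col α) ⬝ᵥ
          (demodulatorMatrix R (chips e)).col α‖ ≤ 2 := by
        have h1 := h α α
        rw [if_pos rfl] at h1
        have h2 : ‖star ((demodulatorMatrix R (chips e)).col α) ⬝ᵥ
          (demodulatorMatrix R (chips e)).col α - 1‖ ≤ 1 := by
          rw [← sq_le_one_iff₀ (norm_nonneg _)]
          exact h1.trans htsmall
        have h3 := norm_add_le (star ((demodulatorMatrix R (chips e)).col α) ⬝ᵥ
          (demodulatorMatrix R (chips e)).col α - 1) 1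
        rw [sub_add_cancel, norm_one] at h3
        linarith
      have h4 := card_filter_le_cumulativeCoherence_le hK (demodulatorMatrix R (chips e))
        (B := 2 * t ^ 2) (E := L * 2) (by rw [ht2]; positivity) hc
        (fun α ω hαω => by simpa [hαω] using h α ω) fun α => by
          rw [sum_norm_inner_sq_eq hWpos (chips e) (fun j => sgn_mul_self _)]
          exact mul_le_mul_of_nonneg_left (hdiag α) hL0.le
      refine h4.trans ?_
      calc W * ((R * L).choose K * Real.exp ((2 * ((K : ℝ) / W) * (L * 2) -
            (1 / Real.sqrt (16 * l)) ^ 2) / (2 * t ^ 2)))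
          ≤ W * ((R * L).choose K * Real.exp (-((2 : ℕ) * l))) := by gcongr
        _ = (0 + W⁻¹) * (R * L).choose K := by
          rw [hexp]
          field_simp
          ring
    · have h1 := Finset.card_filter_le (Finset.univ.powersetCard K) fun S =>
        1 / Real.sqrt (16 * l) ≤ cumulativeCoherence (demodulatorMatrix R (chips e)) S
      rw [Finset.card_powersetCard, Finset.card_univ, Fintype.card_fin] at h1
      have h2 := Nat.cast_le (α := ℝ) |>.2 h1
      have h3 : 0 ≤ W⁻¹ * (R * L).choose K := by positivity
      linarith
  refine (Finset.expect_le_expect fun e _ => hpt e).trans ?_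
  rw [Finset.expect_add_distrib, Fintype.expect_const]
  have h1 := expect_not_gram_close_le hWpos (Real.sqrt_nonneg (40960 * l / R)) ht256
  have h2 : (R : ℝ) * t ^ 2 / 8192 = (5 : ℕ) * l := by
    rw [ht2]
    push_cast
    field_simp
    norm_num
  rw [← ht, ← hWdef, h2, hexp] at h1
  have h3 : W ^ 2 * (4 * (W ^ 5)⁻¹) ≤ W⁻¹ := by
    have : W ^ 2 * (4 * (W ^ 5)⁻¹) = 4 / W ^ 2 * W⁻¹ := by field_simp
    rw [this]
    refine mul_le_of_le_one_left (by positivity) ?_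
    rw [div_le_one (by positivity)]
    nlinarith
  have h4 : 0 ≤ W⁻¹ := by positivity
  linarith

end RandomDemodulator

end

theorem theorem4 :
    ∃ C : ℝ, 0 < C ∧
      ∀ (W R K : ℕ), 0 < W → R ∣ W → K ≤ W →
        C * (K * Real.log W + Real.log W ^ 3) ≤ R →
        ∀ (Ω : Type*) [MeasurableSpace Ω] (P : Measure Ω) [IsProbabilityMeasure P]
          (ε : Fin W → Ω → ℝ) (S : Ω → Finset (Fin W)),
          RandomDemodulator.IsRademacherSequence P ε →
          RandomDemodulator.IsUniformSubset P K S →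
          IndepFun (fun x j => ε j x) S P →
          P.real {x | 1 / Real.sqrt (16 * Real.log W) ≤
              RandomDemodulator.cumulativeCoherence
                (RandomDemodulator.demodulatorMatrix R (fun j => ε j x)) (S x)}
            ≤ 3 * (W : ℝ)⁻¹ := by
  -- With coherence bound `B = 81920 log W / R`, Chernoff's exponent `1 / (32 B log W)` is at least
  -- `2 log W` as soon as `R ≥ 64 * 81920 * log³ W`.
  refine ⟨5242880, by norm_num, ?_⟩
  rintro W R K hW ⟨L, rfl⟩ hK hC Ω _ P _ ε S hε hS hind
  rcases Nat.lt_or_ge (R * L) 4 with h4 | h4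
  · -- For `W ≤ 3` the right-hand side is at least one.
    refine measureReal_le_one.trans ?_
    rw [← div_eq_mul_inv, le_div_iff₀ (by exact_mod_cast hW), one_mul]
    exact_mod_cast Nat.le_of_lt_succ h4
  · classical
    refine (RandomDemodulator.measureReal_le_expect hK hε hS hind fun ε' T =>
      1 / Real.sqrt (16 * Real.log (R * L : ℕ)) ≤ RandomDemodulator.cumulativeCoherence
        (RandomDemodulator.demodulatorMatrix R ε') T).trans ?_
    rw [RandomDemodulator.expect_eq_expect_chips fun ε' =>
      (((Finset.univ.powersetCard K).filter fun T => 1 / Real.sqrt (16 * Real.log (R * L : ℕ)) ≤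
        RandomDemodulator.cumulativeCoherence
          (RandomDemodulator.demodulatorMatrix R ε') T).card : ℝ) / (R * L).choose K]
    exact RandomDemodulator.expect_card_filter_le h4 hK hC
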